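/- Let $n\ge 1$ and let $P$ be a convex $(n+4)$-gon with vertices labelled cyclically by $\mathbb{Z}_{n+4}$. A triangulation of $P$ (without extra vertices) is called triangle-free if none of its triangles has three internal edges (chords). A chord is short if it joins the vertices $i-1$ and $i+1$ for some $i$. A proper coloring of a triangle-free triangulation labels its $n+1$ chords by $0,\dots,n$ as follows: some short chord is labelled $0$; inductively, a chord that is not yet labelled and lies in a triangle together with the chord labelled $i$ is labelled $i+1$. Let $CTFT(n)$ be the set of properly colored triangle-free triangulations of $P$. The colored flip graph $\Gamma_n$ has vertex set $CTFT(n)$, two elements being adjacent if one is obtained from the other by a flip of the chord labelled $i$, for some $i$ (this chord is replaced by the other diagonal of the quadrangle formed by the two triangles containing it; the new chord gets the label $i$ and all other labels stay the same). Let $\phi: CTFT(n)\to CTFT(n)$ be the map that reverses the coloring, replacing each color $i$ by $n-i$. Then for every $T\in CTFT(n)$ the distance in $\Gamma_n$ between $T$ and $\phi(T)$ is equal to the diameter of $\Gamma_n$, and this diameter is $\frac{(n+1)(n+4)}{2}$. -/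

import Mathlib

namespace FlipGraph

/-- The vertices of a convex `(n+4)`-gon, labelled in cyclic order by `ℤ/(n+4)`. -/
abbrev Vertex (n : ℕ) : Type := ZMod (n + 4)

variable {n : ℕ}

/-- `e` is an edge of the polygon (an external edge). -/
def IsExternal (e : Sym2 (Vertex n)) : Prop :=
  ∃ i : Vertex n, e = s(i, i + 1)

/-- `e` joins two distinct, non-adjacent vertices of the polygon. -/
def IsDiagonal (e : Sym2 (Vertex n)) : Prop :=
  ¬ e.IsDiag ∧ ¬ IsExternal e

/-- `e` joins the vertices `i - 1` and `i + 1` for some `i`. -/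
def IsShort (e : Sym2 (Vertex n)) : Prop :=
  ∃ i : Vertex n, e = s(i - 1, i + 1)

/-- The segments `e` and `f` cross in an interior point of the convex polygon: their end points
`a, b` and `c, d` are four distinct vertices, in the cyclic order `a, c, b, d`. -/
def Crossing (e f : Sym2 (Vertex n)) : Prop :=
  ∃ a b c d : Vertex n, e = s(a, b) ∧ f = s(c, d) ∧ sbtw a c b ∧ sbtw b d a

/-- `T` is the set of chords (internal edges) of a triangulation of the polygon without extra
vertices: a maximal set of pairwise non-crossing diagonals. -/
structure IsTriangulation (T : Set (Sym2 (Vertex n))) : Prop where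
  diagonal : ∀ e ∈ T, IsDiagonal e
  noncrossing : ∀ e ∈ T, ∀ f ∈ T, ¬ Crossing e f
  maximal : ∀ e, IsDiagonal e → (∀ f ∈ T, ¬ Crossing e f) → e ∈ T

/-- `e` is an edge, external or internal, of the triangulation with set of chords `T`. -/
def IsEdge (T : Set (Sym2 (Vertex n))) (e : Sym2 (Vertex n)) : Prop :=
  IsExternal e ∨ e ∈ T

/-- `a, b, c` are the vertices of a triangle of the triangulation with set of chords `T`.
(The polygon is convex and all vertices lie on its boundary, so three vertices that are pairwise
joined by edges of a triangulation always bound one of its triangles.) -/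
def IsTriangle (T : Set (Sym2 (Vertex n))) (a b c : Vertex n) : Prop :=
  (a ≠ b ∧ b ≠ c ∧ a ≠ c) ∧ IsEdge T s(a, b) ∧ IsEdge T s(b, c) ∧ IsEdge T s(a, c)

/-- No triangle of `T` has three internal edges. -/
def IsTriangleFree (T : Set (Sym2 (Vertex n))) : Prop :=
  ∀ a b c, IsTriangle T a b c → IsExternal s(a, b) ∨ IsExternal s(b, c) ∨ IsExternal s(a, c)

/-- `chord i` is the chord labelled `i` in a proper coloring of the chords of `T` by `0, …, n`:
the labels are used once each and for all chords of `T`, label `0` is on a short chord, and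
label `i + 1` is on a chord not labelled before that lies in a triangle of `T` together with
the chord labelled `i`. -/
structure IsProperColoring (T : Set (Sym2 (Vertex n))) (chord : Fin (n + 1) → Sym2 (Vertex n)) :
    Prop where
  injective : Function.Injective chord
  range_eq : Set.range chord = T
  short : IsShort (chord 0)
  step : ∀ i : Fin n, ∃ a b c, IsTriangle T a b c ∧
    chord i.castSucc = s(a, b) ∧ chord i.succ = s(b, c)

/-- Properly colored triangle-free triangulations of the convex `(n+4)`-gon; `chord i` is the
chord colored `i`. The underlying triangulation is `Set.range chord`. -/
@[ext]
structure CTFT (n : ℕ) where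
  chord : Fin (n + 1) → Sym2 (Vertex n)
  isTriangulation : IsTriangulation (Set.range chord)
  isTriangleFree : IsTriangleFree (Set.range chord)
  isProperColoring : IsProperColoring (Set.range chord) chord

/-- `T'` is obtained from `T` by a flip of the chord colored `i`: this chord is a diagonal `ac` of
the quadrangle `abcd` formed by two triangles of `T`, and it is replaced by the other diagonal
`bd`, which is colored `i` again. -/
def FlipAt (i : Fin (n + 1)) (T T' : CTFT n) : Prop :=
  (∃ a b c d, b ≠ d ∧ IsTriangle (Set.range T.chord) a b c ∧ IsTriangle (Set.range T.chord) a d c ∧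
    T.chord i = s(a, c) ∧ T'.chord i = s(b, d)) ∧
  ∀ j, j ≠ i → T'.chord j = T.chord j

/-- The colored flip graph `Γ_n`: two colored triangulations are adjacent if one of them is
obtained from the other by a flip of a chord. -/
def flipGraph (n : ℕ) : SimpleGraph (CTFT n) :=
  SimpleGraph.fromRel fun T T' => ∃ i, FlipAt i T T'

theorem sbtw_add (a : Vertex n) (p q r : ℕ) (h₁ : p < q) (h₂ : q < r) (h₃ : r < n + 4) :
    sbtw (a + (p : Vertex n)) (a + (q : Vertex n)) (a + (r : Vertex n)) := by
  have key : ∀ m : ℕ, m < n + 4 → (a + (m : Vertex n)).val =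
      if a.val + m < n + 4 then a.val + m else a.val + m - (n + 4) := by
    intro m hm
    have ha : a.val < n + 4 := ZMod.val_lt a
    rw [ZMod.val_add, ZMod.val_natCast, Nat.mod_eq_of_lt hm]
    split_ifs with h
    · exact Nat.mod_eq_of_lt h
    · rw [Nat.mod_eq_sub_mod (by omega), Nat.mod_eq_of_lt (by omega)]
  have ha : a.val < n + 4 := ZMod.val_lt a
  have hp := key p (by omega)
  have hq := key q (by omega)
  have hr := key r h₃
  have : ∀ x y z : Vertex n, (x.val < y.val ∧ y.val < z.val ∨ y.val < z.val ∧ z.val < x.val ∨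
      z.val < x.val ∧ x.val < y.val) → sbtw x y z := fun x y z h => h
  apply this
  rw [hp, hq, hr]
  split_ifs <;> omega

/-- The first `i + 1` chords of a proper coloring cut off a polygon with `i + 3` vertices. -/
theorem CTFT.chord_eq (T : CTFT n) (i : ℕ) (hi : i < n + 1) :
    ∃ a : Vertex n, T.chord ⟨i, hi⟩ = s(a, a + (i : Vertex n) + 2) ∧
      (i = 0 ∨ ∃ j : Fin (n + 1), j.val + 1 = i ∧
        (T.chord j = s(a, a + (i : Vertex n) + 1) ∨
          T.chord j = s(a + 1, a + (i : Vertex n) + 2))) := by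
  induction i with
  | zero =>
    obtain ⟨m, hm⟩ := T.isProperColoring.short
    refine ⟨m - 1, ?_, Or.inl rfl⟩
    have : (⟨0, hi⟩ : Fin (n + 1)) = 0 := rfl
    rw [this, hm]
    congr 1
    push_cast
    ring_nf
  | succ i ih =>
    obtain ⟨a, ha, hprev⟩ := ih (by omega)
    obtain ⟨u, v, w, htri, h1, h2⟩ := T.isProperColoring.step ⟨i, by omega⟩
    have e1 : (Fin.castSucc ⟨i, by omega⟩ : Fin (n + 1)) = ⟨i, by omega⟩ := rfl
    have e2 : (Fin.succ ⟨i, by omega⟩ : Fin (n + 1)) = ⟨i + 1, hi⟩ := rfl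
    rw [e1] at h1
    rw [e2] at h2
    have d1 := T.isTriangulation.diagonal _ ⟨⟨i, by omega⟩, h1⟩
    have d2 := T.isTriangulation.diagonal _ ⟨⟨i + 1, hi⟩, h2⟩
    have hext : IsExternal s(u, w) := by
      rcases T.isTriangleFree u v w htri with h | h | h
      · exact absurd h d1.2
      · exact absurd h d2.2
      · exact h
    have hw : w = u + 1 ∨ w = u - 1 := by
      obtain ⟨m, hm⟩ := hext
      rcases Sym2.eq_iff.1 hm with ⟨rfl, rfl⟩ | ⟨rfl, rfl⟩
      · exact Or.inl rfl
      · exact Or.inr (by ring)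
    -- the new chord does not lie inside the polygon that is already cut off
    have hbad : T.chord ⟨i + 1, hi⟩ ≠ s(a, a + (i : Vertex n) + 1) ∧
        T.chord ⟨i + 1, hi⟩ ≠ s(a + 1, a + (i : Vertex n) + 2) := by
      rcases hprev with rfl | ⟨j, hj, hprev⟩
      · constructor
        · intro h
          refine d2.2 ⟨a, ?_⟩
          rw [← h2, h]; simp
        · intro h
          refine d2.2 ⟨a + 1, ?_⟩
          rw [← h2, h]; congr 1 <;> (push_cast; ring)
      · have hcross : Crossing (s(a, a + (i : Vertex n) + 1) : Sym2 (Vertex n))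
            s(a + 1, a + (i : Vertex n) + 2) := by
          refine ⟨_, _, _, _, rfl, rfl, ?_, ?_⟩
          · have := sbtw_add a 0 1 (i + 1) (by omega) (by omega) (by omega)
            simpa [add_assoc] using this
          · have := sbtw_add a 0 (i + 1) (i + 2) (by omega) (by omega) (by omega)
            have := sbtw_cyclic_left this
            simpa [add_assoc] using this
        have hne : T.chord ⟨i + 1, hi⟩ ≠ T.chord j := by
          intro h
          have := congrArg Fin.val (T.isProperColoring.injective h)
          simp only at this
          omega
        have hnc := T.isTriangulation.noncrossing
        rcases hprev with hp | hp
        · refine ⟨fun h => hne (h.trans hp.symm), fun h => ?_⟩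
          exact hnc _ ⟨j, hp⟩ _ ⟨_, h⟩ hcross
        · refine ⟨fun h => ?_, fun h => hne (h.trans hp.symm)⟩
          exact hnc _ ⟨_, h⟩ _ ⟨j, hp⟩ hcross
    rw [ha] at h1
    rcases Sym2.eq_iff.1 h1 with ⟨rfl, rfl⟩ | ⟨rfl, rfl⟩
    · rcases hw with rfl | rfl
      · exact absurd (h2.trans Sym2.eq_swap) hbad.2
      · refine ⟨a - 1, ?_, Or.inr ⟨⟨i, by omega⟩, rfl, Or.inr ?_⟩⟩
        · rw [h2, Sym2.eq_swap]; congr 1 <;> (push_cast; ring)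
        · rw [ha]; congr 1 <;> (push_cast; ring)
    · rcases hw with rfl | rfl
      · refine ⟨a, ?_, Or.inr ⟨⟨i, by omega⟩, rfl, Or.inl ?_⟩⟩
        · rw [h2]; congr 1 <;> (push_cast; ring)
        · rw [ha]; congr 1 <;> (push_cast; ring)
      · refine absurd (h2.trans ?_) hbad.1
        congr 1; ring_nf

/-- The chord with the last color is short, too. -/
theorem CTFT.isShort_last (T : CTFT n) : IsShort (T.chord (Fin.last n)) := by
  obtain ⟨a, ha, -⟩ := T.chord_eq n (by omega)
  refine ⟨a - 1, ?_⟩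
  have h0 : ((n + 4 : ℕ) : Vertex n) = 0 := ZMod.natCast_self (n + 4)
  push_cast at h0
  have h1 : (n : Vertex n) = -4 := by linear_combination h0
  have e : Fin.last n = ⟨n, by omega⟩ := rfl
  rw [e, ha, Sym2.eq_swap, h1, show a + (-4 : Vertex n) + 2 = a - 1 - 1 by ring, sub_add_cancel]

/-- The color-reversing map `φ : CTFT(n) → CTFT(n)`: each color `i` is replaced by `n - i`
(which is `Fin.rev i`). -/
def CTFT.colorReverse (T : CTFT n) : CTFT n where
  chord i := T.chord i.rev
  isTriangulation := by
    have h : Set.range (fun i : Fin (n + 1) => T.chord i.rev) = Set.range T.chord :=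
      Fin.rev_surjective.range_comp T.chord
    rw [h]; exact T.isTriangulation
  isTriangleFree := by
    have h : Set.range (fun i : Fin (n + 1) => T.chord i.rev) = Set.range T.chord :=
      Fin.rev_surjective.range_comp T.chord
    rw [h]; exact T.isTriangleFree
  isProperColoring := by
    have h : Set.range (fun i : Fin (n + 1) => T.chord i.rev) = Set.range T.chord :=
      Fin.rev_surjective.range_comp T.chord
    rw [h]
    refine ⟨T.isProperColoring.injective.comp Fin.rev_injective, h, ?_, fun i => ?_⟩
    · simpa using T.isShort_last
    · obtain ⟨a, b, c, ⟨⟨hab, hbc, hac⟩, e1, e2, e3⟩, h1, h2⟩ := T.isProperColoring.step i.rev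
      refine ⟨c, b, a, ⟨⟨hbc.symm, hab.symm, hac.symm⟩, ?_, ?_, ?_⟩, ?_, ?_⟩
      · rwa [Sym2.eq_swap]
      · rwa [Sym2.eq_swap]
      · rwa [Sym2.eq_swap]
      · rw [Fin.rev_castSucc, h2, Sym2.eq_swap]
      · rw [Fin.rev_succ, h1, Sym2.eq_swap]

end FlipGraph

/-!
A properly colored triangle-free triangulation is a nested sequence of polygons, each cut off by
one chord and each obtained from the preceding one by adding a vertex on the left or on the right.
Hence it is encoded by a lattice path `h 0, …, h n` with steps `0` and `-1`, whose `i`-th chord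
joins `h i` to `h i + i + 2` modulo `N = n + 4` (`CTFT.ofPath`, `CTFT.exists_isLift`), and
this path is unique up to translation by multiples of `N` (`IsStaircase.exists_period`). A flip of
the chord colored `i` changes the single value `h i` by `1`.

So walks in the flip graph lift to walks between lattice paths (`CTFT.IsLift.exists_of_walk`).
The distance of two lattice paths is the number `∑ |g i - h i|` of squares between them, since a
path that lies somewhere below another one has a corner there that can be raised
(`edist_ofPath_le`). The distance of two triangulations is therefore the minimum over `k` of
`∑ |d i + k * N|`, where consecutive values of `d = g - h` differ by at most `1`.

* Upper bound (`exists_two_mul_sum_natAbs_le`): either `d` stays between two consecutive multiples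
  of `N`, and the two corresponding translates have sums adding up to `(n + 1) * N`; or `d` hits a
  multiple of `N`, and then one translate is bounded by `|i - i₀|` for some `i₀`, so its sum is at
  most `n * (n + 1) / 2`.
* Lower bound (`le_edist_colorReverse`): reversing the colors turns `h` into
  `i ↦ h (n - i) + (n - i) + 2`, so `d i + d (n - i)` is an odd multiple of `N` for every lift of
  the reversed triangulation. Summing over `i` gives `2 * ∑ |d i| ≥ (n + 1) * N`.
-/

namespace FlipGraph

variable {n : ℕ}

/-! ### Integer coordinates on the polygon -/

theorem exists_intCast_eq (m : ℤ) (v : Vertex n) :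
    ∃ x : ℤ, m ≤ x ∧ x < m + (n + 4) ∧ (x : Vertex n) = v := by
  have h0 : ((n + 4 : ℕ) : ℤ) = n + 4 := by push_cast; ring
  refine ⟨m + ((v - (m : Vertex n)).val : ℤ), by omega, ?_, ?_⟩
  · have := ZMod.val_lt (v - (m : Vertex n))
    omega
  · push_cast
    rw [ZMod.natCast_zmod_val]
    ring

theorem intCast_eq_iff_dvd {x y : ℤ} : (x : Vertex n) = y ↔ ((n : ℤ) + 4) ∣ y - x := by
  rw [ZMod.intCast_eq_intCast_iff_dvd_sub]
  push_cast
  rfl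

theorem intCast_injOn {m x y : ℤ} (hx : m ≤ x) (hx' : x < m + (n + 4)) (hy : m ≤ y)
    (hy' : y < m + (n + 4)) (h : (x : Vertex n) = y) : x = y := by
  have := Int.eq_zero_of_abs_lt_dvd (intCast_eq_iff_dvd.1 h) (by rw [abs_lt]; omega)
  omega

theorem intCast_add_period (x : ℤ) : ((x + (n + 4) : ℤ) : Vertex n) = x := by
  rw [intCast_eq_iff_dvd]
  exact ⟨-1, by ring⟩

theorem sbtw_intCast {m x y z : ℤ} (hx : m ≤ x) (hxy : x < y) (hyz : y < z)
    (hz : z < m + (n + 4)) : sbtw (x : Vertex n) y z := by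
  have := sbtw_add (n := n) (m : Vertex n) (x - m).toNat (y - m).toNat (z - m).toNat
    (by omega) (by omega) (by omega)
  have key : ∀ t : ℤ, m ≤ t → (m : Vertex n) + ((t - m).toNat : Vertex n) = t := by
    intro t ht
    have : (((t - m).toNat : ℤ) : Vertex n) = ((t - m : ℤ) : Vertex n) := by
      rw [Int.toNat_of_nonneg (by omega)]
    rw [Int.cast_natCast] at this
    rw [this]
    push_cast
    ring
  rwa [key x hx, key y (by omega), key z (by omega)] at this

/-- Inside a window of `n + 4` consecutive integers the cyclic order is visible as the order
of the integers. -/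
theorem sbtw_intCast_iff {m x y z : ℤ} (hx : m ≤ x) (hx' : x < m + (n + 4)) (hy : m ≤ y)
    (hy' : y < m + (n + 4)) (hz : m ≤ z) (hz' : z < m + (n + 4)) :
    sbtw (x : Vertex n) y z ↔ x < y ∧ y < z ∨ y < z ∧ z < x ∨ z < x ∧ x < y := by
  constructor
  · intro h
    by_contra hcon
    have h1 : x ≠ y := by rintro rfl; exact sbtw_irrefl_left h
    have h2 : y ≠ z := by rintro rfl; exact sbtw_irrefl_right h
    have h3 : x ≠ z := by rintro rfl; exact sbtw_irrefl_left_right h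
    have h4 : sbtw (z : Vertex n) y x := by
      rcases lt_or_gt_of_ne h1 with h1 | h1 <;> rcases lt_or_gt_of_ne h2 with h2 | h2 <;>
        rcases lt_or_gt_of_ne h3 with h3 | h3 <;> try omega
      · exact sbtw_cyclic_left (sbtw_intCast (n := n) hx h3 h2 hy')
      · exact sbtw_cyclic_right (sbtw_intCast (n := n) hy h1 h3 hz')
      · exact sbtw_intCast (n := n) hz h2 h1 hx'
    exact sbtw_asymm h h4
  · rintro (⟨h1, h2⟩ | ⟨h1, h2⟩ | ⟨h1, h2⟩)
    · exact sbtw_intCast hx h1 h2 hz'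
    · exact sbtw_cyclic_right (sbtw_intCast hy h1 h2 hx')
    · exact sbtw_cyclic_left (sbtw_intCast hz h1 h2 hy')

theorem crossing_intCast_iff {m x y u v : ℤ} (hx : m ≤ x) (hxy : x < y) (hy : y < m + (n + 4))
    (hu : m ≤ u) (huv : u < v) (hv : v < m + (n + 4)) :
    Crossing (s((x : Vertex n), (y : Vertex n))) s((u : Vertex n), (v : Vertex n)) ↔
      x < u ∧ u < y ∧ y < v ∨ u < x ∧ x < v ∧ v < y := by
  constructor
  · rintro ⟨a, b, c, d, he, hf, h1, h2⟩
    rcases Sym2.eq_iff.1 he with ⟨rfl, rfl⟩ | ⟨rfl, rfl⟩ <;>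
      rcases Sym2.eq_iff.1 hf with ⟨rfl, rfl⟩ | ⟨rfl, rfl⟩ <;>
      rw [sbtw_intCast_iff (m := m) (by omega) (by omega) (by omega) (by omega) (by omega)
        (by omega)] at h1 h2 <;> omega
  · rintro (h | h)
    · refine ⟨x, y, u, v, rfl, rfl, ?_, ?_⟩ <;>
        rw [sbtw_intCast_iff (m := m) (by omega) (by omega) (by omega) (by omega) (by omega)
          (by omega)] <;> omega
    · refine ⟨x, y, v, u, rfl, Sym2.eq_swap, ?_, ?_⟩ <;>
        rw [sbtw_intCast_iff (m := m) (by omega) (by omega) (by omega) (by omega) (by omega)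
          (by omega)] <;> omega

theorem isExternal_intCast_succ (x : ℤ) :
    IsExternal (s((x : Vertex n), ((x + 1 : ℤ) : Vertex n))) :=
  ⟨x, by push_cast; rfl⟩

theorem isExternal_intCast_iff {m x y : ℤ} (hx : m ≤ x) (hxy : x < y) (hy : y < m + (n + 4)) :
    IsExternal (s((x : Vertex n), (y : Vertex n))) ↔ y = x + 1 ∨ x = m ∧ y = m + n + 3 := by
  constructor
  · rintro ⟨i, hi⟩
    obtain ⟨t, ht, ht', rfl⟩ := exists_intCast_eq m i
    by_cases hlast : t = m + n + 3
    · have h1 : ((t : Vertex n) + 1) = (m : Vertex n) := by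
        rw [← intCast_add_period m, hlast]; push_cast; ring
      rw [h1] at hi
      rcases Sym2.eq_iff.1 hi with ⟨h, h'⟩ | ⟨h, h'⟩
      · have := intCast_injOn (n := n) (m := m) (by omega) (by omega) (by omega) (by omega) h'
        omega
      · have := intCast_injOn (n := n) (m := m) (by omega) (by omega) (by omega) (by omega) h
        have := intCast_injOn (n := n) (m := m) (by omega) (by omega) (by omega) (by omega) h'
        omega
    · have h1 : ((t : Vertex n) + 1) = ((t + 1 : ℤ) : Vertex n) := by push_cast; rfl
      rw [h1] at hi
      rcases Sym2.eq_iff.1 hi with ⟨h, h'⟩ | ⟨h, h'⟩ <;>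
      · have := intCast_injOn (n := n) (m := m) (by omega) (by omega) (by omega) (by omega) h
        have := intCast_injOn (n := n) (m := m) (by omega) (by omega) (by omega) (by omega) h'
        omega
  · rintro (rfl | ⟨rfl, rfl⟩)
    · exact isExternal_intCast_succ x
    · refine ⟨((x + n + 3 : ℤ) : Vertex n), ?_⟩
      rw [Sym2.eq_swap, ← intCast_add_period x]
      push_cast
      congr 1
      ring_nf

theorem sym2_intCast_eq_iff {m x y u v : ℤ} (hx : m ≤ x) (hxy : x < y) (hy : y < m + (n + 4))
    (hu : m ≤ u) (huv : u < v) (hv : v < m + (n + 4)) :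
    (s((x : Vertex n), (y : Vertex n))) = s((u : Vertex n), (v : Vertex n)) ↔ x = u ∧ y = v := by
  constructor
  · intro h
    rcases Sym2.eq_iff.1 h with ⟨h, h'⟩ | ⟨h, h'⟩ <;>
    · have := intCast_injOn (n := n) (m := m) (by omega) (by omega) (by omega) (by omega) h
      have := intCast_injOn (n := n) (m := m) (by omega) (by omega) (by omega) (by omega) h'
      omega
  · rintro ⟨rfl, rfl⟩; rfl

/-- Every pair of distinct vertices is given by two integers `x < y` of a prescribed window. -/
theorem exists_sym2_eq (m : ℤ) (e : Sym2 (Vertex n)) (he : ¬ e.IsDiag) :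
    ∃ x y : ℤ, m ≤ x ∧ x < y ∧ y < m + (n + 4) ∧ e = s((x : Vertex n), (y : Vertex n)) := by
  induction e using Sym2.ind with
  | _ a b =>
    obtain ⟨x, hx, hx', rfl⟩ := exists_intCast_eq m a
    obtain ⟨y, hy, hy', rfl⟩ := exists_intCast_eq m b
    have hne : x ≠ y := by rintro rfl; exact he rfl
    rcases lt_or_gt_of_ne hne with h | h
    · exact ⟨x, y, hx, h, hy', rfl⟩
    · exact ⟨y, x, hy, h, hx', Sym2.eq_swap⟩

/-! ### Lattice paths and the triangulations they encode -/

/-- A lattice path with `n` steps, each of which goes down by `0` or `1`. Only the values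
`h 0, …, h n` matter. -/
def IsStaircase (n : ℕ) (h : ℕ → ℤ) : Prop :=
  ∀ i < n, h (i + 1) = h i ∨ h (i + 1) = h i - 1

/-- The `i`-th chord encoded by a lattice path: it cuts off the vertices
`h i, …, h i + i + 2` (modulo `n + 4`). -/
def pathChord (n : ℕ) (h : ℕ → ℤ) (i : ℕ) : Sym2 (Vertex n) :=
  s((h i : Vertex n), ((h i + i + 2 : ℤ) : Vertex n))

theorem pathChord_succ_of_eq {h : ℕ → ℤ} {i : ℕ} (hi : h (i + 1) = h i) :
    pathChord n h (i + 1) = s((h i : Vertex n), ((h i + i + 3 : ℤ) : Vertex n)) := by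
  rw [pathChord, hi, show h i + (i + 1 : ℕ) + 2 = h i + i + 3 by push_cast; ring]

theorem pathChord_succ_of_sub {h : ℕ → ℤ} {i : ℕ} (hi : h (i + 1) = h i - 1) :
    pathChord n h (i + 1) = s(((h i - 1 : ℤ) : Vertex n), ((h i + i + 2 : ℤ) : Vertex n)) := by
  rw [pathChord, hi, show h i - 1 + (i + 1 : ℕ) + 2 = h i + i + 2 by push_cast; ring]

/-- The intervals `[h i, h i + i + 2]` increase with `i`. -/
theorem IsStaircase.nested {h : ℕ → ℤ} (hs : IsStaircase n h) {i j : ℕ} (hij : i ≤ j)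
    (hj : j ≤ n) : h j ≤ h i ∧ h i + i ≤ h j + j := by
  induction j, hij using Nat.le_induction with
  | base => exact ⟨le_rfl, le_rfl⟩
  | succ j hij ih =>
    have := ih (by omega)
    have := hs j (by omega)
    push_cast
    omega

/-- A chord between vertices `x < y` of the window starting one below `h n` which crosses no
chord of the path is one of its chords. -/
theorem IsStaircase.exists_eq_of_not_crossing {h : ℕ → ℤ} (hs : IsStaircase n h) {x y : ℤ}
    (hx : h n - 1 ≤ x) (hy : y < h n + n + 3) (hxy : x + 2 ≤ y)
    (hne : ¬ (x = h n - 1 ∧ y = h n + n + 2))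
    (hc : ∀ i ≤ n, ¬ (x < h i ∧ h i < y ∧ y < h i + i + 2 ∨
      h i < x ∧ x < h i + i + 2 ∧ h i + i + 2 < y)) :
    ∃ i ≤ n, x = h i ∧ y = h i + i + 2 := by
  by_contra! hno
  -- The chord stays on the same side of all chords of the path.
  have hc0 := hc 0 (by omega)
  have hno0 := hno 0 (by omega)
  have key : ∀ i ≤ n, (x ≤ h 0 ∧ h 0 + 2 ≤ y → x ≤ h i ∧ h i + i + 2 ≤ y) ∧
      (y ≤ h 0 → y ≤ h i) ∧ (h 0 + 2 ≤ x → h i + i + 2 ≤ x) := by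
    intro i
    induction i with
    | zero => intro _; push_cast; omega
    | succ i ih =>
      intro hi
      have ih := ih (by omega)
      have h1 := hs i (by omega)
      have h2 := hc (i + 1) hi
      have h3 := hno i (by omega)
      have h4 := hs.nested (Nat.zero_le i) (by omega)
      push_cast at *
      refine ⟨fun hh => ?_, fun hh => ?_, fun hh => ?_⟩
      · have := ih.1 hh; omega
      · have := ih.2.1 hh; omega
      · have := ih.2.2 hh; omega
  have := key n le_rfl
  have := hno n le_rfl
  push_cast at *
  omega

/-- The properly colored triangle-free triangulation encoded by a lattice path. -/
def CTFT.ofPath (h : ℕ → ℤ) (hs : IsStaircase n h) : CTFT n where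
  chord i := pathChord n h i
  isTriangulation := by
    refine ⟨?_, ?_, ?_⟩
    · rintro _ ⟨i, rfl⟩
      have hi := hs.nested (show (i : ℕ) ≤ n by omega) le_rfl
      refine ⟨fun hd => ?_, fun he => ?_⟩
      · have := intCast_injOn (n := n) (m := h n) (by omega) (by omega) (by omega) (by omega)
          (Sym2.mk_isDiag_iff.1 hd)
        omega
      · simp only [pathChord] at he
        rw [isExternal_intCast_iff (m := h n) (by omega) (by omega) (by omega)] at he
        omega
    · rintro _ ⟨i, rfl⟩ _ ⟨j, rfl⟩ hc
      have hi := hs.nested (show (i : ℕ) ≤ n by omega) le_rfl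
      have hj := hs.nested (show (j : ℕ) ≤ n by omega) le_rfl
      simp only [pathChord] at hc
      rw [crossing_intCast_iff (m := h n) (by omega) (by omega) (by omega) (by omega) (by omega)
        (by omega)] at hc
      rcases le_total (i : ℕ) j with hij | hij
      · have := hs.nested hij (by omega); omega
      · have := hs.nested hij (by omega); omega
    · intro e he hc
      obtain ⟨x, y, hx, hxy, hy, rfl⟩ := exists_sym2_eq (h n - 1) e he.1
      have hext := he.2
      rw [isExternal_intCast_iff (m := h n - 1) hx hxy hy] at hext
      obtain ⟨i, hi, h1, h2⟩ := hs.exists_eq_of_not_crossing (x := x) (y := y) hx (by omega)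
        (by omega) (by omega) (fun i hi hcr => by
          have hb := hs.nested hi le_rfl
          refine hc _ ⟨⟨i, by omega⟩, rfl⟩ ?_
          simp only [pathChord]
          rw [crossing_intCast_iff (m := h n - 1) hx hxy hy (by omega) (by omega) (by omega)]
          omega)
      exact ⟨⟨i, by omega⟩, by simp only [pathChord]; rw [h1, h2]⟩
  isTriangleFree := by
    rintro a b c ⟨⟨hab, hbc, hac⟩, e1, e2, e3⟩
    by_contra! hcon
    have f1 := e1.resolve_left hcon.1
    have f2 := e2.resolve_left hcon.2.1
    have f3 := e3.resolve_left hcon.2.2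
    clear e1 e2 e3 hcon
    -- For `x < y < z` the chords `xy` and `yz` cannot both occur, as they are not nested.
    have key : ∀ x y z : ℤ, h n - 1 ≤ x → x < y → y < z → z < h n - 1 + (n + 4) →
        s((x : Vertex n), (y : Vertex n)) ∈ Set.range (fun i : Fin (n + 1) => pathChord n h i) →
        s((y : Vertex n), (z : Vertex n)) ∈ Set.range (fun i : Fin (n + 1) => pathChord n h i) →
        False := by
      rintro x y z hx hxy hyz hz ⟨i, hi⟩ ⟨j, hj⟩
      have hbi := hs.nested (show (i : ℕ) ≤ n by omega) le_rfl
      have hbj := hs.nested (show (j : ℕ) ≤ n by omega) le_rfl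
      simp only [pathChord] at hi hj
      rw [sym2_intCast_eq_iff (m := h n - 1) (by omega) (by omega) (by omega) (by omega)
        (by omega) (by omega)] at hi hj
      rcases le_total (i : ℕ) j with hij | hij
      · have := hs.nested hij (by omega); omega
      · have := hs.nested hij (by omega); omega
    obtain ⟨x, hx, hx', rfl⟩ := exists_intCast_eq (h n - 1) a
    obtain ⟨y, hy, hy', rfl⟩ := exists_intCast_eq (h n - 1) b
    obtain ⟨z, hz, hz', rfl⟩ := exists_intCast_eq (h n - 1) c
    have g1 : x ≠ y := by rintro rfl; exact hab rfl
    have g2 : y ≠ z := by rintro rfl; exact hbc rfl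
    have g3 : x ≠ z := by rintro rfl; exact hac rfl
    have f1' := f1
    have f2' := f2
    have f3' := f3
    rw [Sym2.eq_swap] at f1' f2' f3'
    rcases lt_or_gt_of_ne g1 with g1 | g1 <;> rcases lt_or_gt_of_ne g2 with g2 | g2 <;>
      rcases lt_or_gt_of_ne g3 with g3 | g3 <;> try omega
    · exact key x y z hx g1 g2 hz' f1 f2
    · exact key x z y hx g3 g2 hy' f3 f2'
    · exact key z x y hz g3 g1 hy' f3' f1
    · exact key y x z hy g1 g3 hz' f1' f3
    · exact key y z x hy g2 g3 hx' f2 f3'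
    · exact key z y x hz g2 g1 hx' f2' f1'
  isProperColoring := by
    refine ⟨fun i j hij => ?_, rfl, ⟨((h 0 + 1 : ℤ) : Vertex n), ?_⟩, fun i => ?_⟩
    · have hbi := hs.nested (show (i : ℕ) ≤ n by omega) le_rfl
      have hbj := hs.nested (show (j : ℕ) ≤ n by omega) le_rfl
      simp only [pathChord] at hij
      rw [sym2_intCast_eq_iff (m := h n) (by omega) (by omega) (by omega) (by omega)
        (by omega) (by omega)] at hij
      omega
    · simp only [pathChord, Fin.val_zero]
      push_cast
      rw [show (h 0 : Vertex n) + 1 - 1 = h 0 by ring,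
        show (h 0 : Vertex n) + 1 + 1 = h 0 + 0 + 2 by ring]
    · have hb := hs.nested (show (i : ℕ) + 1 ≤ n by omega) le_rfl
      have hne : ∀ x y : ℤ, h n - 1 ≤ x → x < y → y < h n - 1 + (n + 4) →
          (x : Vertex n) ≠ y ∧ (y : Vertex n) ≠ x := by
        intro x y hx hxy hy
        have : (x : Vertex n) ≠ y := fun he => by
          have := intCast_injOn (n := n) (m := h n - 1) (by omega) (by omega) (by omega)
            (by omega) he
          omega
        exact ⟨this, this.symm⟩
      have hi : pathChord n h i ∈ Set.range (fun i : Fin (n + 1) => pathChord n h i) :=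
        ⟨i.castSucc, rfl⟩
      have hi' : pathChord n h (i + 1) ∈ Set.range (fun i : Fin (n + 1) => pathChord n h i) :=
        ⟨i.succ, by simp⟩
      simp only [Fin.val_castSucc, Fin.val_succ]
      push_cast at hb
      rcases hs i i.2 with h1 | h1
      · refine ⟨((h i + i + 2 : ℤ) : Vertex n), (h i : Vertex n), ((h i + i + 3 : ℤ) : Vertex n),
          ⟨⟨(hne _ _ (by omega) (by omega) (by omega)).2,
            (hne _ _ (by omega) (by omega) (by omega)).1,
            (hne _ _ (by omega) (by omega) (by omega)).1⟩, ?_, ?_, ?_⟩, ?_, ?_⟩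
        · exact Or.inr (by rw [Sym2.eq_swap]; exact hi)
        · refine Or.inr ?_
          rwa [pathChord_succ_of_eq h1] at hi'
        · refine Or.inl ?_
          have := isExternal_intCast_succ (n := n) (h i + i + 2)
          rwa [show h i + i + 2 + 1 = h i + i + 3 by ring] at this
        · rw [pathChord, Sym2.eq_swap]
        · rw [pathChord_succ_of_eq h1]
      · refine ⟨(h i : Vertex n), ((h i + i + 2 : ℤ) : Vertex n), ((h i - 1 : ℤ) : Vertex n),
          ⟨⟨(hne _ _ (by omega) (by omega) (by omega)).1,
            (hne _ _ (by omega) (by omega) (by omega)).2,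
            (hne _ _ (by omega) (by omega) (by omega)).2⟩, ?_, ?_, ?_⟩, ?_, ?_⟩
        · exact Or.inr hi
        · refine Or.inr ?_
          rwa [pathChord_succ_of_sub h1, Sym2.eq_swap] at hi'
        · refine Or.inl ?_
          have := isExternal_intCast_succ (n := n) (h i - 1)
          rwa [show h i - 1 + 1 = h i by ring, Sym2.eq_swap] at this
        · rw [pathChord]
        · rw [pathChord_succ_of_sub h1, Sym2.eq_swap]

/-! ### Every colored triangulation comes from a lattice path -/

/-- The lattice path `h` encodes the colored triangulation `T`. -/
structure CTFT.IsLift (T : CTFT n) (h : ℕ → ℤ) : Prop where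
  staircase : IsStaircase n h
  chord_eq : ∀ i : Fin (n + 1), T.chord i = pathChord n h i

theorem CTFT.IsLift.eq_ofPath {T : CTFT n} {h : ℕ → ℤ} (hT : T.IsLift h) :
    T = CTFT.ofPath h hT.staircase :=
  CTFT.ext (funext hT.chord_eq)

theorem CTFT.IsLift.add_period {T : CTFT n} {h : ℕ → ℤ} (hT : T.IsLift h) (k : ℤ) :
    T.IsLift fun j => h j + k * (n + 4) := by
  refine ⟨fun i hi => ?_, fun i => ?_⟩
  · have := hT.staircase i hi
    omega
  · rw [hT.chord_eq i, pathChord, pathChord]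
    refine Sym2.eq_iff.2 (Or.inl ⟨?_, ?_⟩)
    · rw [intCast_eq_iff_dvd]
      exact ⟨k, by ring⟩
    · rw [intCast_eq_iff_dvd]
      exact ⟨k, by ring⟩

/-- A chord extends the polygon cut off by its predecessor by one vertex, on one of the two
sides. -/
theorem CTFT.chord_succ (T : CTFT n) (i : Fin n) (x : ℤ)
    (hx : T.chord i.castSucc = s((x : Vertex n), ((x + i + 2 : ℤ) : Vertex n)))
    (hprev : i.val = 0 ∨ ∃ j : Fin (n + 1), j.val + 1 = i.val ∧
      (T.chord j = s((x : Vertex n), ((x + i + 1 : ℤ) : Vertex n)) ∨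
        T.chord j = s(((x + 1 : ℤ) : Vertex n), ((x + i + 2 : ℤ) : Vertex n)))) :
    T.chord i.succ = s((x : Vertex n), ((x + i + 3 : ℤ) : Vertex n)) ∨
      T.chord i.succ = s(((x - 1 : ℤ) : Vertex n), ((x + i + 2 : ℤ) : Vertex n)) := by
  obtain ⟨u, v, w, htri, h1, h2⟩ := T.isProperColoring.step i
  have d1 := T.isTriangulation.diagonal _ ⟨i.castSucc, h1⟩
  have d2 := T.isTriangulation.diagonal _ ⟨i.succ, h2⟩
  have hext : IsExternal s(u, w) := by
    rcases T.isTriangleFree u v w htri with h | h | h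
    · exact absurd h d1.2
    · exact absurd h d2.2
    · exact h
  have hw : w = u + 1 ∨ w = u - 1 := by
    obtain ⟨m, hm⟩ := hext
    rcases Sym2.eq_iff.1 hm with ⟨rfl, rfl⟩ | ⟨rfl, rfl⟩
    · exact Or.inl rfl
    · exact Or.inr (by ring)
  -- The new chord does not lie inside the polygon that is already cut off.
  have hbad : T.chord i.succ ≠ s((x : Vertex n), ((x + i + 1 : ℤ) : Vertex n)) ∧
      T.chord i.succ ≠ s(((x + 1 : ℤ) : Vertex n), ((x + i + 2 : ℤ) : Vertex n)) := by
    rcases hprev with h0 | ⟨j, hj, hprev⟩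
    · rw [h0]
      constructor
      · intro h
        rw [h2] at h
        refine d2.2 (h ▸ ?_)
        simpa using isExternal_intCast_succ (n := n) x
      · intro h
        rw [h2] at h
        refine d2.2 (h ▸ ?_)
        have := isExternal_intCast_succ (n := n) (x + 1)
        rwa [show x + 1 + 1 = x + (0 : ℕ) + 2 by push_cast; ring] at this
    · have hcross : Crossing (s((x : Vertex n), ((x + i + 1 : ℤ) : Vertex n)))
          s(((x + 1 : ℤ) : Vertex n), ((x + i + 2 : ℤ) : Vertex n)) := by
        rw [crossing_intCast_iff (m := x)] <;> omega
      have hne : T.chord i.succ ≠ T.chord j := by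
        intro h
        have := congrArg Fin.val (T.isProperColoring.injective h)
        rw [Fin.val_succ] at this
        omega
      have hnc := T.isTriangulation.noncrossing
      rcases hprev with hp | hp
      · exact ⟨fun h => hne (h.trans hp.symm), fun h => hnc _ ⟨j, hp⟩ _ ⟨_, h⟩ hcross⟩
      · exact ⟨fun h => hnc _ ⟨_, h⟩ _ ⟨j, hp⟩ hcross, fun h => hne (h.trans hp.symm)⟩
  rw [hx] at h1
  rcases Sym2.eq_iff.1 h1 with ⟨rfl, rfl⟩ | ⟨rfl, rfl⟩
  · rcases hw with rfl | rfl
    · refine absurd (h2.trans Sym2.eq_swap) ?_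
      simpa using hbad.2
    · right
      rw [h2, Sym2.eq_swap]
      push_cast
      rfl
  · rcases hw with rfl | rfl
    · left
      rw [h2, show x + i + 3 = x + i + 2 + 1 by ring]
      push_cast
      rfl
    · refine absurd h2 ?_
      have := hbad.1
      rw [show x + i + 1 = x + i + 2 - 1 by ring] at this
      push_cast at this ⊢
      exact this

theorem CTFT.exists_isLift (T : CTFT n) : ∃ h, T.IsLift h := by
  suffices key : ∀ i (_ : i ≤ n), ∃ h : ℕ → ℤ,
      (∀ j < i, h (j + 1) = h j ∨ h (j + 1) = h j - 1) ∧
      ∀ j : Fin (n + 1), j.val ≤ i → T.chord j = pathChord n h j by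
    obtain ⟨h, h1, h2⟩ := key n le_rfl
    exact ⟨h, h1, fun i => h2 i (by omega)⟩
  intro i
  induction i with
  | zero =>
    intro _
    obtain ⟨m, hm⟩ := T.isProperColoring.short
    obtain ⟨x, -, -, rfl⟩ := exists_intCast_eq 0 m
    refine ⟨fun _ => x - 1, by simp, fun j hj => ?_⟩
    have : j = 0 := Fin.ext (by simpa using hj)
    subst this
    rw [hm, pathChord, Fin.val_zero]
    rw [show x - 1 + (0 : ℕ) + 2 = x + 1 by push_cast; ring]
    push_cast
    rfl
  | succ i ih =>
    intro hi
    obtain ⟨h, h1, h2⟩ := ih (by omega)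
    have hx := h2 (Fin.castSucc ⟨i, by omega⟩) le_rfl
    have hstep := T.chord_succ ⟨i, by omega⟩ (h i) hx (by
      rcases i with _ | i
      · exact Or.inl rfl
      · refine Or.inr ⟨⟨i, by omega⟩, rfl, ?_⟩
        rw [h2 ⟨i, by omega⟩ (Nat.le_succ i), pathChord]
        dsimp only
        rcases h1 i (by omega) with h3 | h3
        · left
          rw [h3, show h i + (i + 1 : ℕ) + 1 = h i + i + 2 by push_cast; ring]
        · right
          rw [h3, show h i - 1 + (i + 1 : ℕ) + 2 = h i + i + 2 by push_cast; ring,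
            sub_add_cancel])
    have hext : ∀ y, (y = h i ∨ y = h i - 1) →
        T.chord (Fin.succ ⟨i, by omega⟩) =
          s((y : Vertex n), ((y + (i + 1 : ℕ) + 2 : ℤ) : Vertex n)) →
        ∃ g : ℕ → ℤ, (∀ j < i + 1, g (j + 1) = g j ∨ g (j + 1) = g j - 1) ∧
          ∀ j : Fin (n + 1), j.val ≤ i + 1 → T.chord j = pathChord n g j := by
      intro y hy hyc
      refine ⟨Function.update h (i + 1) y, fun j hj => ?_, fun j hj => ?_⟩
      · rw [Function.update_of_ne (show j ≠ i + 1 by omega)]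
        rcases Nat.lt_succ_iff_lt_or_eq.1 hj with hj | rfl
        · rw [Function.update_of_ne (show j + 1 ≠ i + 1 by omega)]
          exact h1 j hj
        · rwa [Function.update_self]
      · rw [pathChord]
        by_cases hji : j.val = i + 1
        · rw [hji, Function.update_self]
          rw [← hyc]
          congr 1
          exact Fin.ext hji
        · rw [Function.update_of_ne hji]
          exact h2 j (by omega)
    rcases hstep with hstep | hstep
    · refine hext (h i) (Or.inl rfl) (hstep.trans ?_)
      dsimp only
      rw [show h i + (i + 1 : ℕ) + 2 = h i + i + 3 by push_cast; ring]
    · refine hext (h i - 1) (Or.inr rfl) (hstep.trans ?_)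
      dsimp only
      rw [show h i - 1 + (i + 1 : ℕ) + 2 = h i + i + 2 by push_cast; ring]

/-! ### Paths of triangulations that differ in at most one chord -/

theorem dvd_or_of_pathChord_eq {h g : ℕ → ℤ} {j : ℕ} (hj : j ≤ n)
    (heq : pathChord n h j = pathChord n g j) :
    ((n : ℤ) + 4) ∣ g j - h j ∨ 2 * j = n ∧ ((n : ℤ) + 4) ∣ g j - h j - (j + 2) := by
  rcases Sym2.eq_iff.1 heq with ⟨h1, -⟩ | ⟨h1, h2⟩
  · exact Or.inl (intCast_eq_iff_dvd.1 h1)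
  · right
    rw [intCast_eq_iff_dvd] at h1 h2
    have h3 := dvd_sub h1 h2
    have h5 : ((n : ℤ) + 4) ∣ 2 * (j + 2 : ℤ) - (n + 4) := by
      obtain ⟨c, hc⟩ := h3
      exact ⟨c - 1, by linear_combination hc⟩
    have h4 := Int.eq_zero_of_abs_lt_dvd h5 (by rw [abs_lt]; omega)
    refine ⟨by omega, ?_⟩
    rwa [show g j - h j - (j + 2) = g j - (h j + j + 2) by ring]

/-- If two paths encode the same chord for all colors but at most one, then they agree there up
to a common multiple of `n + 4`. (A chord through the center of the polygon does not tell its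
two ends apart, but the chord next to it decides.) -/
theorem IsStaircase.exists_period (hn : 0 < n) {h g : ℕ → ℤ} (hh : IsStaircase n h)
    (hg : IsStaircase n g) (i : ℕ)
    (heq : ∀ j ≤ n, j ≠ i → pathChord n h j = pathChord n g j) :
    ∃ k : ℤ, (∀ j ≤ n, j ≠ i → g j - h j = k * (n + 4)) ∧
      (i ≤ n → |g i - h i - k * (n + 4)| ≤ 1) := by
  have hdiff : ∀ j < n, |(g (j + 1) - h (j + 1)) - (g j - h j)| ≤ 1 := by
    intro j hj
    have := hh j hj
    have := hg j hj
    rw [abs_le]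
    omega
  have hdvd : ∀ j ≤ n, j ≠ i → ((n : ℤ) + 4) ∣ g j - h j := by
    intro j hj hji
    refine (dvd_or_of_pathChord_eq hj (heq j hj hji)).resolve_right ?_
    rintro ⟨hjn, hd⟩
    obtain ⟨j', hj', hne, hneq, hab⟩ : ∃ j' ≤ n, j' ≠ i ∧ j' ≠ j ∧
        |(g j - h j) - (g j' - h j')| ≤ 1 := by
      by_cases h1 : j + 1 = i
      · refine ⟨j - 1, by omega, by omega, by omega, ?_⟩
        have := hdiff (j - 1) (by omega)
        rwa [show j - 1 + 1 = j by omega] at this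
      · refine ⟨j + 1, by omega, h1, by omega, ?_⟩
        rw [abs_sub_comm]
        exact hdiff j (by omega)
    have hd' := (dvd_or_of_pathChord_eq hj' (heq j' hj' hne)).resolve_right (by omega)
    rw [abs_le] at hab
    have := Int.eq_zero_of_abs_lt_dvd (dvd_sub hd hd') (by rw [abs_lt]; omega)
    omega
  -- Adding `1` before dividing rounds correctly also at the exceptional index.
  have hround : ∀ a b : ℤ, ((n : ℤ) + 4) ∣ a → |b - a| ≤ 1 →
      (b + 1) / ((n : ℤ) + 4) * (n + 4) = a := by
    rintro _ b ⟨c, rfl⟩ hb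
    rw [abs_le] at hb
    have : (b + 1) / ((n : ℤ) + 4) = c := by
      rw [show b + 1 = (b + 1 - (n + 4) * c) + ((n : ℤ) + 4) * c by ring,
        Int.add_mul_ediv_left _ _ (by omega), Int.ediv_eq_zero_of_lt (by omega) (by omega),
        zero_add]
    rw [this, mul_comm]
  have hconst : ∀ j ≤ n, (g j - h j + 1) / ((n : ℤ) + 4) = (g 0 - h 0 + 1) / ((n : ℤ) + 4) := by
    intro j
    induction j with
    | zero => intro _; rfl
    | succ j ih =>
      intro hj
      rw [← ih (by omega)]
      have hN : ((n : ℤ) + 4) ≠ 0 := by omega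
      apply mul_right_cancel₀ hN
      have hd := hdiff j (by omega)
      by_cases hji : j = i
      · have hdv := hdvd (j + 1) hj (by omega)
        rw [hround _ _ hdv (by simp), hround _ _ hdv (by rwa [abs_sub_comm])]
      · have hdv := hdvd j (by omega) hji
        rw [hround _ _ hdv hd, hround _ _ hdv (by simp)]
  have hmain : ∀ j ≤ n, j ≠ i →
      g j - h j = (g 0 - h 0 + 1) / ((n : ℤ) + 4) * (n + 4) := by
    intro j hj hji
    rw [← hconst j hj, hround _ _ (hdvd j hj hji) (by simp)]
  refine ⟨_, hmain, fun hi => ?_⟩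
  rcases Nat.eq_zero_or_pos i with rfl | hpos
  · rw [← hmain 1 hn (by omega), abs_sub_comm]
    exact hdiff 0 hn
  · rw [← hmain (i - 1) (by omega) (by omega)]
    have := hdiff (i - 1) (by omega)
    rwa [show i - 1 + 1 = i by omega] at this

/-! ### Walks in the flip graph and paths -/

/-- The number of unit squares between two lattice paths. -/
def pathDist (n : ℕ) (h g : ℕ → ℤ) : ℕ :=
  ∑ j ∈ Finset.range (n + 1), (g j - h j).natAbs

theorem pathDist_comm (h g : ℕ → ℤ) : pathDist n h g = pathDist n g h :=
  Finset.sum_congr rfl fun j _ => by omega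

theorem pathDist_triangle (h g f : ℕ → ℤ) :
    pathDist n h f ≤ pathDist n h g + pathDist n g f := by
  rw [pathDist, pathDist, pathDist, ← Finset.sum_add_distrib]
  exact Finset.sum_le_sum fun j _ => by omega

theorem CTFT.IsLift.exists_of_adj (hn : 0 < n) {T T' : CTFT n} (hadj : (flipGraph n).Adj T T')
    {h : ℕ → ℤ} (hT : T.IsLift h) : ∃ g, T'.IsLift g ∧ pathDist n h g ≤ 1 := by
  obtain ⟨i, hi⟩ : ∃ i : Fin (n + 1), ∀ j, j ≠ i → T.chord j = T'.chord j := by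
    rw [flipGraph, SimpleGraph.fromRel_adj] at hadj
    rcases hadj.2 with ⟨i, -, hi⟩ | ⟨i, -, hi⟩
    · exact ⟨i, fun j hj => (hi j hj).symm⟩
    · exact ⟨i, hi⟩
  obtain ⟨g, hg⟩ := T'.exists_isLift
  obtain ⟨k, hk, hki⟩ := hT.staircase.exists_period hn hg.staircase i (fun j hj hji => by
    have := hi ⟨j, by omega⟩ (fun hc => hji (by rw [← hc]))
    rwa [hT.chord_eq, hg.chord_eq] at this)
  refine ⟨_, hg.add_period (-k), ?_⟩
  rw [pathDist, Finset.sum_eq_single i.val]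
  · have := hki (by omega)
    rw [abs_le] at this
    rw [neg_mul]
    omega
  · intro j hj hji
    rw [Finset.mem_range] at hj
    have := hk j (by omega) hji
    rw [neg_mul]
    omega
  · intro hc
    exact absurd (Finset.mem_range.2 i.2) hc

theorem CTFT.IsLift.exists_of_walk (hn : 0 < n) {T T' : CTFT n} (w : (flipGraph n).Walk T T') :
    ∀ {h : ℕ → ℤ}, T.IsLift h → ∃ g, T'.IsLift g ∧ pathDist n h g ≤ w.length := by
  induction w with
  | nil => exact fun {h} hT => ⟨h, hT, by simp [pathDist]⟩
  | cons hadj w ih =>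
    intro h hT
    obtain ⟨g, hg, hd⟩ := hT.exists_of_adj hn hadj
    obtain ⟨f, hf, hd'⟩ := ih hg
    refine ⟨f, hf, (pathDist_triangle h g f).trans ?_⟩
    rw [SimpleGraph.Walk.length_cons]
    omega

/-- Raising one value of a lattice path by `1` is a flip. -/
theorem flipAt_of_raise {h g : ℕ → ℤ} (hh : IsStaircase n h) (hg : IsStaircase n g)
    (i : Fin (n + 1)) (hi : g i = h i + 1) (hne : ∀ j, j ≠ i.val → g j = h j) :
    FlipAt i (CTFT.ofPath h hh) (CTFT.ofPath g hg) := by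
  have hin : i.val ≤ n := by omega
  have hdis : ∀ x y : ℤ, h i ≤ x → x < y → y < h i + (n + 4) → (x : Vertex n) ≠ y := by
    intro x y hx hxy hy he
    have := intCast_injOn (n := n) (m := h i) (by omega) (by omega) (by omega) (by omega) he
    omega
  have hchord : s((h i : Vertex n), ((h i + i + 2 : ℤ) : Vertex n)) ∈
      Set.range (CTFT.ofPath h hh).chord := ⟨i, rfl⟩
  have hab : IsExternal (s((h i : Vertex n), ((h i + 1 : ℤ) : Vertex n))) :=
    isExternal_intCast_succ _
  have hdc : IsExternal (s(((h i + i + 3 : ℤ) : Vertex n), ((h i + i + 2 : ℤ) : Vertex n))) := by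
    rw [Sym2.eq_swap, isExternal_intCast_iff (m := h i)] <;> omega
  have hbc : IsEdge (Set.range (CTFT.ofPath h hh).chord)
      (s(((h i + 1 : ℤ) : Vertex n), ((h i + i + 2 : ℤ) : Vertex n))) := by
    by_cases h0 : i.val = 0
    · left
      rw [isExternal_intCast_iff (m := h i)] <;> omega
    · right
      refine ⟨⟨i - 1, by omega⟩, ?_⟩
      have h1 := hh (i - 1) (by omega)
      have h2 := hg (i - 1) (by omega)
      have h3 := hne (i - 1) (by omega)
      rw [show i.val - 1 + 1 = i by omega] at h1 h2
      have h4 : h (i - 1) = h i + 1 := by omega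
      simp only [CTFT.ofPath, pathChord]
      rw [h4, show h i + 1 + (i.val - 1 : ℕ) + 2 = h i + i + 2 by omega]
  have had : IsEdge (Set.range (CTFT.ofPath h hh).chord)
      (s((h i : Vertex n), ((h i + i + 3 : ℤ) : Vertex n))) := by
    by_cases h0 : i.val = n
    · left
      rw [isExternal_intCast_iff (m := h i)] <;> omega
    · right
      refine ⟨⟨i + 1, by omega⟩, ?_⟩
      have h1 := hh i (by omega)
      have h2 := hg i (by omega)
      have h3 := hne (i + 1) (by omega)
      exact pathChord_succ_of_eq (by omega)
  refine ⟨⟨(h i : Vertex n), ((h i + 1 : ℤ) : Vertex n), ((h i + i + 2 : ℤ) : Vertex n),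
    ((h i + i + 3 : ℤ) : Vertex n), hdis _ _ (by omega) (by omega) (by omega),
    ⟨⟨hdis _ _ (by omega) (by omega) (by omega), hdis _ _ (by omega) (by omega) (by omega),
      hdis _ _ (by omega) (by omega) (by omega)⟩, Or.inl hab, hbc, Or.inr hchord⟩,
    ⟨⟨hdis _ _ (by omega) (by omega) (by omega),
      (hdis _ _ (by omega) (by omega) (by omega)).symm,
      hdis _ _ (by omega) (by omega) (by omega)⟩, had, Or.inl hdc, Or.inr hchord⟩, rfl, ?_⟩, ?_⟩
  · simp only [CTFT.ofPath, pathChord]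
    rw [hi, show h i + 1 + i + 2 = h i + i + 3 by ring]
  · intro j hj
    simp only [CTFT.ofPath, pathChord]
    rw [hne j (fun hc => hj (Fin.ext hc))]

theorem adj_of_raise {h g : ℕ → ℤ} (hh : IsStaircase n h) (hg : IsStaircase n g)
    (i : Fin (n + 1)) (hi : g i = h i + 1) (hne : ∀ j, j ≠ i.val → g j = h j) :
    (flipGraph n).Adj (CTFT.ofPath h hh) (CTFT.ofPath g hg) := by
  rw [flipGraph, SimpleGraph.fromRel_adj]
  refine ⟨fun heq => ?_, Or.inl ⟨i, flipAt_of_raise hh hg i hi hne⟩⟩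
  have := congrFun (congrArg CTFT.chord heq) i
  simp only [CTFT.ofPath, pathChord] at this
  rw [sym2_intCast_eq_iff (m := h i)] at this <;> omega

/-- If `h` is somewhere below `g`, then it can be raised there in a suitable place. -/
theorem IsStaircase.exists_raise {h g : ℕ → ℤ} (hh : IsStaircase n h) (hg : IsStaircase n g)
    (hlt : ∃ i ≤ n, h i < g i) :
    ∃ i ≤ n, h i < g i ∧ IsStaircase n (Function.update h i (h i + 1)) := by
  -- An obstruction at `i` comes from a neighbor where `h` is again below `g` and where
  -- `2 * h i + i` is smaller.
  obtain ⟨i, hi, hmin⟩ := Finset.exists_min_image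
    ((Finset.range (n + 1)).filter fun i => h i < g i) (fun i => 2 * h i + i) (by
      obtain ⟨i, hi, hlt⟩ := hlt
      exact ⟨i, by simp only [Finset.mem_filter, Finset.mem_range]; omega⟩)
  simp only [Finset.mem_filter, Finset.mem_range] at hi hmin
  refine ⟨i, by omega, hi.2, fun j hj => ?_⟩
  have h1 := hh j hj
  have h2 := hg j hj
  by_cases hji : j = i
  · subst hji
    rw [Function.update_self, Function.update_of_ne (by omega)]
    by_contra hc
    have := hmin (j + 1) (by omega)
    push_cast at this
    omega
  · rw [Function.update_of_ne hji]
    by_cases hji' : j + 1 = i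
    · subst hji'
      rw [Function.update_self]
      by_contra hc
      have := hmin j (by omega)
      push_cast at this
      omega
    · rwa [Function.update_of_ne hji']

theorem edist_ofPath_le (S : ℕ) : ∀ {h g : ℕ → ℤ} (hh : IsStaircase n h) (hg : IsStaircase n g),
    pathDist n h g = S →
      (flipGraph n).edist (CTFT.ofPath h hh) (CTFT.ofPath g hg) ≤ (S : ℕ∞) := by
  induction S with
  | zero =>
    intro h g hh hg hS
    have heq : CTFT.ofPath h hh = CTFT.ofPath g hg := by
      refine CTFT.ext (funext fun i => ?_)
      have := (Finset.sum_eq_zero_iff.1 hS) i (Finset.mem_range.2 i.2)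
      simp only [CTFT.ofPath, pathChord]
      rw [show h i = g i by omega]
    rw [heq, SimpleGraph.edist_self]
    exact zero_le
  | succ S ih =>
    have main : ∀ {h g : ℕ → ℤ} (hh : IsStaircase n h) (hg : IsStaircase n g),
        pathDist n h g = S + 1 → (∃ i ≤ n, h i < g i) →
        (flipGraph n).edist (CTFT.ofPath h hh) (CTFT.ofPath g hg) ≤ ((S + 1 : ℕ) : ℕ∞) := by
      intro h g hh hg hS hlt
      obtain ⟨i, hi, hlt, hs⟩ := hh.exists_raise hg hlt
      have hmem : i ∈ Finset.range (n + 1) := Finset.mem_range.2 (by omega)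
      have hS' : pathDist n (Function.update h i (h i + 1)) g = S := by
        rw [pathDist, ← Finset.add_sum_erase _ _ hmem] at hS ⊢
        have : ∑ j ∈ (Finset.range (n + 1)).erase i,
            (g j - Function.update h i (h i + 1) j).natAbs =
            ∑ j ∈ (Finset.range (n + 1)).erase i, (g j - h j).natAbs :=
          Finset.sum_congr rfl fun j hj => by
            rw [Function.update_of_ne (Finset.ne_of_mem_erase hj)]
        rw [this, Function.update_self]
        omega
      have hadj := adj_of_raise hh hs ⟨i, by omega⟩ (Function.update_self ..)
        (fun j hj => Function.update_of_ne hj ..)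
      calc _ ≤ _ + _ := SimpleGraph.edist_triangle (v := CTFT.ofPath _ hs)
        _ ≤ 1 + (S : ℕ∞) := add_le_add (SimpleGraph.edist_eq_one_iff_adj.2 hadj).le
            (ih hs hg hS')
        _ = _ := by push_cast; rw [add_comm]
    intro h g hh hg hS
    by_cases hlt : ∃ i ≤ n, h i < g i
    · exact main hh hg hS hlt
    · rw [SimpleGraph.edist_comm]
      rw [pathDist_comm] at hS
      refine main hg hh hS ?_
      by_contra! hge
      push Not at hlt
      have : pathDist n g h = 0 := Finset.sum_eq_zero fun j hj => by
        rw [Finset.mem_range] at hj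
        have := hlt j (by omega)
        have := hge j (by omega)
        omega
      omega

/-! ### The diameter -/

theorem two_mul_sum_range_eq (f : ℕ → ℕ) :
    2 * ∑ j ∈ Finset.range (n + 1), f j = ∑ j ∈ Finset.range (n + 1), (f j + f (n - j)) := by
  rw [Finset.sum_add_distrib, two_mul]
  congr 1
  rw [← Finset.sum_range_reflect]
  exact Finset.sum_congr rfl fun j _ => by rw [Nat.add_sub_cancel]

theorem two_mul_sum_natAbs_le_of_eq_zero {d : ℕ → ℤ} (hd : ∀ j < n, |d (j + 1) - d j| ≤ 1)
    {i : ℕ} (hi : i ≤ n) (h0 : d i = 0) :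
    2 * ∑ j ∈ Finset.range (n + 1), (d j).natAbs ≤ (n + 1) * (n + 4) := by
  have hlip : ∀ a b : ℕ, a ≤ b → b ≤ n → |d b - d a| ≤ b - a := by
    intro a b hab
    induction b, hab using Nat.le_induction with
    | base => intro _; simp
    | succ b hab ih =>
      intro hb
      have h1 := ih (by omega)
      have h2 := hd b (by omega)
      rw [abs_le] at *
      push_cast
      omega
  have hbound : ∀ j ≤ n, ((d j).natAbs : ℤ) ≤ |(j : ℤ) - i| := by
    intro j hj
    rcases le_total i j with hij | hij
    · have := hlip i j hij hj
      rw [h0, sub_zero, abs_le] at this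
      rw [abs_of_nonneg (by omega)]
      omega
    · have := hlip j i hij hi
      rw [h0, zero_sub, abs_neg, abs_le] at this
      rw [abs_of_nonpos (by omega)]
      omega
  rw [two_mul_sum_range_eq fun j => (d j).natAbs]
  have : ∀ j ∈ Finset.range (n + 1), (d j).natAbs + (d (n - j)).natAbs ≤ n + 4 := by
    intro j hj
    rw [Finset.mem_range] at hj
    have h1 := hbound j (by omega)
    have h2 := hbound (n - j) (by omega)
    rw [Int.abs_eq_natAbs] at h1 h2
    omega
  simpa using Finset.sum_le_card_nsmul _ _ _ this

/-- If consecutive values of `d` differ by at most `1`, then translating `d` by some multiple of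
`n + 4` makes the mean of its absolute values at most `(n + 4) / 2`. -/
theorem exists_two_mul_sum_natAbs_le {d : ℕ → ℤ} (hd : ∀ j < n, |d (j + 1) - d j| ≤ 1) :
    ∃ k : ℤ, 2 * ∑ j ∈ Finset.range (n + 1), (d j + k * (n + 4)).natAbs ≤ (n + 1) * (n + 4) := by
  have hd' : ∀ k : ℤ, ∀ j < n, |(d (j + 1) + k * (n + 4)) - (d j + k * (n + 4))| ≤ 1 := by
    intro k j hj
    rw [add_sub_add_right_eq_sub]
    exact hd j hj
  by_cases hz : ∃ k : ℤ, ∃ i ≤ n, d i + k * (n + 4) = 0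
  · obtain ⟨k, i, hi, h0⟩ := hz
    exact ⟨k, two_mul_sum_natAbs_le_of_eq_zero (hd' k) hi h0⟩
  · push Not at hz
    -- Now `d` stays between two consecutive multiples of `n + 4`.
    set q : ℤ := d 0 / (n + 4) with hq
    have hin : ∀ j ≤ n, 0 ≤ d j + -q * (n + 4) ∧ d j + -(q + 1) * (n + 4) ≤ 0 := by
      intro j
      have hexp : -(q + 1) * ((n : ℤ) + 4) = -q * (n + 4) - (n + 4) := by ring
      rw [hexp]
      induction j with
      | zero =>
        intro _
        have h1 := Int.emod_add_mul_ediv (d 0) (n + 4)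
        have h2 := Int.emod_nonneg (d 0) (show ((n : ℤ) + 4) ≠ 0 by omega)
        have h3 := Int.emod_lt_of_pos (d 0) (show 0 < ((n : ℤ) + 4) by omega)
        rw [← hq] at h1
        rw [show -q * ((n : ℤ) + 4) = -((n + 4) * q) by ring]
        omega
      | succ j ih =>
        intro hj
        have h1 := ih (by omega)
        have h2 := hd j (by omega)
        have h3 := hz (-q) j (by omega)
        have h4 := hz (-(q + 1)) j (by omega)
        rw [abs_le] at h2
        rw [hexp] at h4
        omega
    have hsum : ∑ j ∈ Finset.range (n + 1), (d j + -q * (n + 4)).natAbs +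
        ∑ j ∈ Finset.range (n + 1), (d j + -(q + 1) * (n + 4)).natAbs = (n + 1) * (n + 4) := by
      rw [← Finset.sum_add_distrib]
      rw [Finset.sum_congr rfl (g := fun _ => n + 4)]
      · simp
      · intro j hj
        rw [Finset.mem_range] at hj
        have h1 := hin j (by omega)
        have hexp : -(q + 1) * ((n : ℤ) + 4) = -q * (n + 4) - (n + 4) := by ring
        rw [hexp] at h1 ⊢
        omega
    rcases le_total (∑ j ∈ Finset.range (n + 1), (d j + -q * (n + 4)).natAbs)
      (∑ j ∈ Finset.range (n + 1), (d j + -(q + 1) * (n + 4)).natAbs) with hle | hle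
    · exact ⟨-q, by omega⟩
    · exact ⟨-(q + 1), by omega⟩

theorem edist_le (T T' : CTFT n) :
    (flipGraph n).edist T T' ≤ (((n + 1) * (n + 4) / 2 : ℕ) : ℕ∞) := by
  obtain ⟨h, hT⟩ := T.exists_isLift
  obtain ⟨g, hT'⟩ := T'.exists_isLift
  obtain ⟨k, hk⟩ := exists_two_mul_sum_natAbs_le (n := n) (d := fun j => g j - h j)
    (fun j hj => by
      have := hT.staircase j hj
      have := hT'.staircase j hj
      rw [abs_le]
      omega)
  have hg := hT'.add_period k
  rw [hT.eq_ofPath, hg.eq_ofPath]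
  refine (edist_ofPath_le _ hT.staircase hg.staircase rfl).trans ?_
  rw [Nat.cast_le, Nat.le_div_iff_mul_le two_pos, mul_comm]
  refine le_trans (le_of_eq ?_) hk
  rw [pathDist]
  congr 1
  exact Finset.sum_congr rfl fun j _ => by congr 1; ring

/-- The path of the triangulation with reversed colors: the chord of color `n - j` is seen from
its other side. -/
theorem CTFT.IsLift.colorReverse {T : CTFT n} {h : ℕ → ℤ} (hT : T.IsLift h) :
    T.colorReverse.IsLift fun j => h (n - j) + (n - j : ℕ) + 2 := by
  refine ⟨fun i hi => ?_, fun i => ?_⟩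
  · have := hT.staircase (n - (i + 1)) (by omega)
    rw [show n - (i + 1) + 1 = n - i by omega] at this
    omega
  · have hi : (i.rev : ℕ) = n - i := by rw [Fin.val_rev]; omega
    have hle : (i : ℕ) ≤ n := by omega
    rw [CTFT.colorReverse, hT.chord_eq, hi, pathChord, pathChord, Sym2.eq_swap,
      show h (n - i) + (n - i : ℕ) + 2 + i + 2 = h (n - i) + (n + 4) by omega,
      intCast_add_period]

theorem le_edist_colorReverse (hn : 0 < n) (T : CTFT n) :
    (((n + 1) * (n + 4) / 2 : ℕ) : ℕ∞) ≤ (flipGraph n).edist T T.colorReverse := by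
  refine le_iInf fun w => ?_
  rw [Nat.cast_le]
  obtain ⟨h, hT⟩ := T.exists_isLift
  obtain ⟨g, hg, hd⟩ := hT.exists_of_walk hn w
  have hr := hT.colorReverse
  obtain ⟨k, hk, -⟩ := hr.staircase.exists_period hn hg.staircase (n + 1) (fun j hj _ => by
    have h1 := hr.chord_eq ⟨j, by omega⟩
    rw [hg.chord_eq] at h1
    exact h1.symm)
  have key : (n + 1) * (n + 4) ≤ 2 * pathDist n h g := by
    rw [pathDist, two_mul_sum_range_eq fun j => (g j - h j).natAbs]
    have : ∀ j ∈ Finset.range (n + 1),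
        n + 4 ≤ (g j - h j).natAbs + (g (n - j) - h (n - j)).natAbs := by
      intro j hj
      rw [Finset.mem_range] at hj
      have h1 := hk j (by omega) (by omega)
      have h2 := hk (n - j) (by omega) (by omega)
      rw [show n - (n - j) = j by omega] at h2
      have h3 : (g j - h j) + (g (n - j) - h (n - j)) = (2 * k + 1) * (n + 4) := by
        have : ((n - j : ℕ) : ℤ) + j = n := by omega
        linear_combination h1 + h2 + this
      have h4 : n + 4 ≤ ((2 * k + 1) * ((n : ℤ) + 4)).natAbs := by
        rw [Int.natAbs_mul]
        have h5 : 1 ≤ (2 * k + 1).natAbs := by omega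
        have h6 : ((n : ℤ) + 4).natAbs = n + 4 := by omega
        rw [h6]
        exact Nat.le_mul_of_pos_left _ h5
      rw [← h3] at h4
      omega
    simpa using Finset.card_nsmul_le_sum _ _ _ this
  omega

end FlipGraph

/-- Distance and diameter are taken in `ℕ∞`, so that the equalities include that they are
finite. The division is exact, since `(n + 1) * (n + 4)` is even. -/
theorem proposition5p6 (n : ℕ) (hn : 0 < n) (T : FlipGraph.CTFT n) :
    (FlipGraph.flipGraph n).edist T T.colorReverse = (FlipGraph.flipGraph n).ediam ∧
      (FlipGraph.flipGraph n).ediam = (((n + 1) * (n + 4) / 2 : ℕ) : ℕ∞) := by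
  have hle : (FlipGraph.flipGraph n).ediam ≤ (((n + 1) * (n + 4) / 2 : ℕ) : ℕ∞) :=
    SimpleGraph.ediam_le_of_edist_le FlipGraph.edist_le
  have hge := FlipGraph.le_edist_colorReverse hn T
  have hdiam : (FlipGraph.flipGraph n).edist T T.colorReverse ≤ (FlipGraph.flipGraph n).ediam :=
    SimpleGraph.edist_le_ediam
  exact ⟨le_antisymm hdiam (hle.trans hge), le_antisymm hle (hge.trans hdiam)⟩
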